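/- **Setting.** Let $m\ge 1$ and let $\mathcal E=\bigoplus_{j=1}^m\mathcal E_j$ be an orthogonal direct sum of finite-dimensional real Euclidean spaces, $G\subset\mathcal E$ compact, and let $M_i$, $i\in\mathbb I$, enumerate the nonempty subsets of $\{1,\dots,m\}$, with $M_1=\{1,\dots,m\}$. Let $T_i:G\to G$ ($i\in\mathbb I$) be blockwise mappings: for given $T_j':\mathcal E\to\mathcal E_j$, $[T_ix]_j=T'_j(x)$ if $j\in M_i$ and $[T_ix]_j=x_j$ otherwise. Assume $T_1$ is almost $\alpha$-firmly nonexpansive on $G$ with constant $\bar\alpha\in(0,1)$ and violation at most $\bar\epsilon\in[0,1)$, i.e. for all $x,y\in G$ $$\|T_1x-T_1y\|^2\le(1+\bar\epsilon)\|x-y\|^2-\tfrac{1-\bar\alpha}{\bar\alpha}\,\|(x-T_1x)-(y-T_1y)\|^2 .$$ Let $\xi$ be an $\mathbb I$-valued random variable, $\eta_i=\mathbb P(\xi=i)$, $p_j=\sum_{i:\,j\in M_i}\eta_i$, assumed $>0$ for all $j$, $\bar p=\max_jp_j$, and $\|z\|_{\bf p}=(\sum_j\|z_j\|^2/p_j)^{1/2}$.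 Let $X^{k+1}=T_{\xi_k}X^k$, where the $\xi_k$ are i.i.d. copies of $\xi$ and $X^0$ is a $G$-valued random variable independent of the sequence $(\xi_k)$; let $\mu_k$ be the law of $X^k$, with $\mu_0\in\mathscr P_2(G)$ (the probability measures on $G$ with finite second moment). Let $\mathcal P$ be the Markov operator $(\mu\mathcal P)(A)=\int_G\mathbb P(T_\xi x\in A)\,\mu(dx)$, $\mathrm{inv}\,\mathcal P$ the set of its invariant probability measures, $d_W$ the Wasserstein $2$-metric with respect to $\|\cdot\|_{\bf p}$, $d_W(\mu,S)=\inf_{\pi\in S}d_W(\mu,\pi)$, and $$\Psi(\mu)=\inf_{\pi\in\mathrm{inv}\,\mathcal P}\ \inf_{\gamma}\Big(\int_{G\times G}\mathbb E\big[\|(x-T_\xi x)-(y-T_\xi y)\|_{\bf p}^2\big]\,\gamma(dx,dy)\Big)^{1/2},$$ where $\gamma$ runs over the $d_W$-optimal couplings of $\mu$ and $\pi$ ($\Psi(\mu)=\infty$ if there are none). Suppose $\mathrm{inv}\,\mathcal P\cap\mathscr P_2(G)\neq\emptyset$. Put $\tau=(1-\bar\alpha)/\bar\alpha$ and $\epsilon=\bar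 p\,\bar\epsilon$. Let $\theta:[0,\infty)\to[0,\infty)$, and let $\rho:[0,\infty)\to[0,\infty)$ be continuous and strictly increasing with $\rho(0)=0$ and $\rho(t)\to\infty$ as $t\to\infty$, such that $$\rho\Big(\big(\tfrac{(1+\epsilon)t^2-\theta(t)^2}{\tau}\big)^{1/2}\Big)=t\qquad\text{for all }t\ge0$$ (the radicand being nonnegative). Suppose that $\Psi$ is gauge metrically subregular with gauge $\rho$: $$d_W(\mu,\mathrm{inv}\,\mathcal P)=d_W(\mu,\Psi^{-1}(0))\le\rho(\Psi(\mu))\qquad\text{for all }\mu\in\mathscr P_2(G)$$ (with $\rho(\infty)=\infty$). **Theorem.** The distances $d_W(\mu_k,\mathrm{inv}\,\mathcal P)$ are finite and $$d_W(\mu_{k+1},\mathrm{inv}\,\mathcal P)\le\theta\big(d_W(\mu_k,\mathrm{inv}\,\mathcal P)\big)\qquad\text{for all }k\in\mathbb N.$$ In addition, let $t_0=d_W(\mu_0,\mathrm{inv}\,\mathcal P)$, and suppose that $\theta(0)=0$ and that there is $\bar t>t_0$ with $0<\theta(t)<t$ for all $t\in(0,\bar t]$. Write $\theta^{(k)}$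 for the $k$-fold composition. (a) Suppose $\theta^{(k)}(t)\to0$ for all $t\in(0,\bar t)$ and $(\mu_k)$ is Fejér monotone: $d_W(\mu_{k+1},\pi)\le d_W(\mu_k,\pi)$ for all $k$ and all $\pi\in\mathrm{inv}\,\mathcal P\cap\mathscr P_2(G)$. Then $\mu_k$ converges in $d_W$ to some $\pi^{\mu_0}\in\mathrm{inv}\,\mathcal P\cap\mathscr P_2(G)$, and if $\theta$ is nondecreasing on $[0,\bar t]$, then $d_W(\mu_k,\pi^{\mu_0})=O(\theta^{(k)}(t_0))$. (b) Suppose $\sum_{j\ge1}\theta^{(j)}(t)<\infty$ for all $t\in(0,\bar t)$ and $\theta$ is nondecreasing on $[0,\bar t]$. Then $\mu_k$ converges in $d_W$ to some $\pi^{\mu_0}\in\mathrm{inv}\,\mathcal P\cap\mathscr P_2(G)$, with $d_W(\mu_k,\pi^{\mu_0})=O\big(\sum_{j\ge k}\theta^{(j)}(t_0)\big)$. Here $O(a_k)$ means: at most $C a_k$ for all $k\in\mathbb N$, with a finite constant $C$ independent of $k$. -/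

import Mathlib

open MeasureTheory ProbabilityTheory Filter Topology
open scoped NNReal ENNReal

noncomputable section

namespace StochasticBlock

/-- The index set: one index for every nonempty subset (of blocks) of `{1, …, m}`.
Its sigma algebra is the discrete one. -/
abbrev BlockIndex (m : ℕ) : Type := {M : Finset (Fin m) // M.Nonempty}

/-- The index whose block set is the whole of `{1, …, m}`. -/
def fullIndex (m : ℕ) [NeZero m] : BlockIndex m := ⟨Finset.univ, Finset.univ_nonempty⟩

section Weights

variable {m : ℕ}

/-- `p_j = ∑_i η_i χ_{M_i}(j)`, the probability that block `j` is among the selected blocks. -/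
def blockProb (η : Measure (BlockIndex m)) (j : Fin m) : ℝ :=
  ∑ i : BlockIndex m, η.real {i} * (if j ∈ i.1 then 1 else 0)

/-- `p̄ = max_j p_j`. -/
def maxBlockProb (η : Measure (BlockIndex m)) : ℝ := ⨆ j, blockProb η j

variable {E : Fin m → Type*} [∀ j, NormedAddCommGroup (E j)] [∀ j, InnerProductSpace ℝ (E j)]

/-- The weighted norm `‖z‖_p = (∑_j ‖z_j‖² / p_j)^{1/2}`. -/
def wnorm (p : Fin m → ℝ) (z : PiLp 2 E) : ℝ := √(∑ j, (1 / p j) * ‖z j‖ ^ 2)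

/-- The weighted transport discrepancy `ψ_p(x, y, x⁺, y⁺) = ‖(x - x⁺) - (y - y⁺)‖_p²`. -/
def wpsi (p : Fin m → ℝ) (x y x' y' : PiLp 2 E) : ℝ := wnorm p ((x - x') - (y - y')) ^ 2

end Weights

section Regularity

variable {V : Type*} [NormedAddCommGroup V]

/-- The (unweighted) transport discrepancy `ψ(x, x₀, x⁺, x₀⁺)`. -/
def psi (x x₀ x' x₀' : V) : ℝ :=
  ‖x' - x‖ ^ 2 + ‖x₀' - x₀‖ ^ 2 + ‖x' - x₀'‖ ^ 2 + ‖x - x₀‖ ^ 2 - ‖x' - x₀‖ ^ 2 - ‖x - x₀'‖ ^ 2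

/-- `F` is almost `α`-firmly nonexpansive on `G`, with constant `α` and violation (at most) `ε`. -/
def AlmostFirmlyNonexpansive {G : Set V} (F : G → G) (α ε : ℝ) : Prop :=
  ∀ x x₀ : G, ‖(F x : V) - F x₀‖ ^ 2 ≤
    (1 + ε) * ‖(x : V) - x₀‖ ^ 2 - (1 - α) / α * psi (x : V) x₀ (F x) (F x₀)

end Regularity

section Chain

variable {m : ℕ} {E : Fin m → Type*}
  [∀ j, NormedAddCommGroup (E j)] [∀ j, InnerProductSpace ℝ (E j)]
  {G : Set (PiLp 2 E)}

/-- The self-mappings `T_i` of `G` are the blockwise mappings built from block updates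
`T'_j : ℰ → ℰ_j`: `[T_i x]_j = T'_j x` if `j ∈ M_i`, and `[T_i x]_j = x_j` otherwise. -/
def IsBlockwise (T : BlockIndex m → G → G) : Prop :=
  ∃ T' : ∀ j, PiLp 2 E → E j, ∀ (i : BlockIndex m) (x : G) (j : Fin m),
    (T i x : PiLp 2 E) j = if j ∈ i.1 then T' j x else (x : PiLp 2 E) j

variable [∀ j, MeasurableSpace (E j)]

/-- The transition kernel `p(x, A) = ℙ(T_ξ x ∈ A)`, where `ξ` has law `η`. -/
def transition (η : Measure (BlockIndex m)) (T : BlockIndex m → G → G) (x : G) : Measure G :=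
  η.map (fun i => T i x)

/-- The dual Markov operator `(μ𝒫)(A) = ∫ p(x, A) μ(dx)`. -/
def markov (η : Measure (BlockIndex m)) (T : BlockIndex m → G → G) (μ : Measure G) : Measure G :=
  μ.bind (transition η T)

/-- The set `inv 𝒫` of invariant probability measures. -/
def inv (η : Measure (BlockIndex m)) (T : BlockIndex m → G → G) : Set (ProbabilityMeasure G) :=
  {π | markov η T (π : Measure G) = π}

/-- The probability measures on `G` with finite second moment. -/
def P2 (p : Fin m → ℝ) (G : Set (PiLp 2 E)) : Set (ProbabilityMeasure G) :=
  {μ | ∃ x : G, ∫⁻ y : G, ENNReal.ofReal (wnorm p ((x : PiLp 2 E) - (y : PiLp 2 E)) ^ 2) ∂(μ : Measure G) < ∞}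

/-- The couplings of `μ` and `ν`: measures on `G × G` with marginals `μ` and `ν`
(they are automatically probability measures). -/
def couplings (μ ν : ProbabilityMeasure G) : Set (Measure (G × G)) :=
  {γ | γ.map Prod.fst = μ ∧ γ.map Prod.snd = ν}

/-- The root mean square transport distance `(∫ ‖x - y‖_p² γ(dx, dy))^{1/2}` of a coupling. -/
def couplingCost (p : Fin m → ℝ) (γ : Measure (G × G)) : ℝ≥0∞ :=
  (∫⁻ z : G × G, ENNReal.ofReal (wnorm p ((z.1 : PiLp 2 E) - (z.2 : PiLp 2 E)) ^ 2) ∂γ) ^ (1 / 2 : ℝ)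

/-- The Wasserstein `2`-metric with respect to the weighted norm. -/
def W2 (p : Fin m → ℝ) (μ ν : ProbabilityMeasure G) : ℝ≥0∞ :=
  ⨅ γ ∈ couplings μ ν, couplingCost p γ

/-- The couplings at which the Wasserstein distance is attained. -/
def optimalCouplings (p : Fin m → ℝ) (μ ν : ProbabilityMeasure G) : Set (Measure (G × G)) :=
  {γ | γ ∈ couplings μ ν ∧ couplingCost p γ = W2 p μ ν}

/-- The Wasserstein distance of a measure to a set of measures. -/
def W2dist (p : Fin m → ℝ) (μ : ProbabilityMeasure G) (S : Set (ProbabilityMeasure G)) : ℝ≥0∞ :=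
  ⨅ π ∈ S, W2 p μ π

/-- The invariant Markov transport discrepancy
`Ψ(μ) = inf_{π ∈ inv 𝒫} inf_{γ ∈ 𝒞_*(μ, π)} (∫ 𝔼[ψ_p(x, y, T_ξ x, T_ξ y)] γ(dx, dy))^{1/2}`,
with value `∞` if the infimum is over the empty set. -/
def Psi (η : Measure (BlockIndex m)) (T : BlockIndex m → G → G) (μ : ProbabilityMeasure G) :
    ℝ≥0∞ :=
  ⨅ π ∈ inv η T, ⨅ γ ∈ optimalCouplings (blockProb η) μ π,
    (∫⁻ z : G × G, ∫⁻ i, ENNReal.ofReal (wpsi (blockProb η) (z.1 : PiLp 2 E) z.2 (T i z.1) (T i z.2)) ∂η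
      ∂γ) ^ (1 / 2 : ℝ)

/-- `Ψ` is gauge metrically subregular for `0` relative to `𝒫₂(G)` on `𝒫₂(G)` with gauge `ρ`:
`d(μ, inv 𝒫) = d(μ, Ψ⁻¹(0)) ≤ ρ(Ψ(μ))` for all `μ ∈ 𝒫₂(G)`.
The inequality is void where `Ψ(μ) = ∞`, in accordance with `ρ(t) → ∞` as `t → ∞`. -/
def GaugeMetricallySubregular (η : Measure (BlockIndex m)) (T : BlockIndex m → G → G)
    (ρ : ℝ≥0 → ℝ≥0) : Prop :=
  ∀ μ ∈ P2 (blockProb η) G,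
    W2dist (blockProb η) μ (inv η T) =
      W2dist (blockProb η) μ {ν | Psi η T ν = 0} ∧
    ∀ r : ℝ≥0, Psi η T μ = r →
      W2dist (blockProb η) μ {ν | Psi η T ν = 0} ≤ ρ r

/-- The stochastic block iteration on a probability space `(Ω, P)`: `X^{k+1} = T_{ξ_k} X^k` with
`(ξ_k)` i.i.d. of law `η` and `X^0` independent of the sequence `(ξ_k)`. -/
structure IsStochasticBlockIteration {Ω : Type*} [MeasurableSpace Ω] (P : Measure Ω)
    (η : Measure (BlockIndex m)) (T : BlockIndex m → G → G)
    (ξ : ℕ → Ω → BlockIndex m) (X : ℕ → Ω → G) : Prop where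
  measurable_init : Measurable (X 0)
  measurable_index : ∀ k, Measurable (ξ k)
  law_index : ∀ k, P.map (ξ k) = η
  indep_index : iIndepFun ξ P
  indep_init : IndepFun (X 0) (fun ω k => ξ k ω) P
  step : ∀ k ω, X (k + 1) ω = T (ξ k ω) (X k ω)

end Chain

/-- Gauge functions: continuous, strictly increasing, zero at zero, tending to infinity. -/
structure IsGauge (ρ : ℝ≥0 → ℝ≥0) : Prop where
  continuous : Continuous ρ
  strictMono : StrictMono ρ
  zero : ρ 0 = 0
  tendsto : Tendsto ρ atTop atTop

/-- The gauge `ρ` is given implicitly in terms of `θ` by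
`ρ((((1 + ε) t² - θ(t)²) / τ)^{1/2}) = t` for all `t ≥ 0`, the radicand being nonnegative. -/
def GaugeRelation (τ ε : ℝ) (ρ θ : ℝ≥0 → ℝ≥0) : Prop :=
  ∀ t : ℝ≥0, (θ t : ℝ) ^ 2 ≤ (1 + ε) * (t : ℝ) ^ 2 ∧
    ρ (Real.toNNReal √(((1 + ε) * (t : ℝ) ^ 2 - (θ t : ℝ) ^ 2) / τ)) = t

end StochasticBlock

end

/-! The weights 1/p_j are chosen so that averaging over the random block turns the selected part of
‖·‖_p² into the unweighted norm of the full update. The inequality for T_1 thus becomes one in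
expectation for T_ξ, with violation p̄ε (`sum_wnorm_sq_add_sum_wpsi_le`). Pushing an optimal
coupling of μ and an invariant π forward by the same random map gives d_W(μ𝒫, π)² + τΨ(μ)² ≤ (1 +
p̄ε) d_W(μ, π)² (`W2_sq_add_Psi_sq_le`).

With t = d_W(μ, inv 𝒫), subregularity and the gauge relation give τΨ(μ)² ≥ (1 + p̄ε)t² - θ(t)².
Letting π run through a minimizing sequence yields both d_W(μ𝒫, inv 𝒫) ≤ θ(t) and d_W(μ, μ𝒫) ≤ t +
θ(t) (`W2dist_le_and_W2_le`).

The gauge relation forces θ to be continuous, so the distances decrease to a number L with L ≤ θ(L),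
hence to 0. A Cauchy rate for μ_k comes from Fejér monotonicity in (a) and from summing the step
lengths in (b). Since G is compact, the probability measures on it are weakly compact; inv 𝒫 is
weakly closed and d_W weakly lower semicontinuous, so `exists_forall_W2_le` gives a limit in inv 𝒫
with the same rate. -/

namespace StochasticBlock

/-! ### The weighted norm. -/

section Norm

variable {m : ℕ} {E : Fin m → Type*} [∀ j, NormedAddCommGroup (E j)] {p : Fin m → ℝ}

lemma wnorm_nonneg (p : Fin m → ℝ) (z : PiLp 2 E) : 0 ≤ wnorm p z := Real.sqrt_nonneg _

lemma wnorm_sq (hp : ∀ j, 0 < p j) (z : PiLp 2 E) :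
    wnorm p z ^ 2 = ∑ j, (1 / p j) * ‖z j‖ ^ 2 :=
  Real.sq_sqrt (Finset.sum_nonneg fun j _ => by have := hp j; positivity)

lemma continuous_wnorm (p : Fin m → ℝ) : Continuous (wnorm p : PiLp 2 E → ℝ) := by
  unfold wnorm
  fun_prop

lemma wnorm_neg (p : Fin m → ℝ) (z : PiLp 2 E) : wnorm p (-z) = wnorm p z := by
  simp [wnorm]

lemma wnorm_sub_comm (p : Fin m → ℝ) (z w : PiLp 2 E) : wnorm p (z - w) = wnorm p (w - z) := by
  rw [← wnorm_neg, neg_sub]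

/-- Converts the violation ε of T_1, measured in the unweighted norm, into the violation p̄ε in the
weighted norm. -/
lemma norm_sq_le_mul_wnorm_sq (hp : ∀ j, 0 < p j) {b : ℝ} (hb : ∀ j, p j ≤ b) (z : PiLp 2 E) :
    ‖z‖ ^ 2 ≤ b * wnorm p z ^ 2 := by
  rw [wnorm_sq hp, PiLp.norm_sq_eq_of_L2, Finset.mul_sum]
  refine Finset.sum_le_sum fun j _ => ?_
  have h : 1 ≤ b * (1 / p j) := by
    rw [mul_one_div, le_div_iff₀ (hp j), one_mul]
    exact hb j
  nlinarith [sq_nonneg ‖z j‖]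

variable [∀ j, InnerProductSpace ℝ (E j)]

/-- Rescaling each block by p_j^{-1/2} is an isometry onto the unweighted space, from which the
triangle inequality is inherited. -/
lemma wnorm_eq_norm (hp : ∀ j, 0 < p j) (z : PiLp 2 E) :
    wnorm p z = ‖(WithLp.toLp 2 (fun j => √(1 / p j) • z j) : PiLp 2 E)‖ := by
  rw [PiLp.norm_eq_of_L2, wnorm]
  congr 1
  refine Finset.sum_congr rfl fun j _ => ?_
  have := hp j
  simp only [norm_smul, mul_pow, Real.norm_eq_abs, sq_abs]
  rw [Real.sq_sqrt (by positivity)]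

lemma wnorm_add_le (hp : ∀ j, 0 < p j) (z w : PiLp 2 E) :
    wnorm p (z + w) ≤ wnorm p z + wnorm p w := by
  simp only [wnorm_eq_norm hp]
  refine le_trans (le_of_eq ?_) (norm_add_le _ _)
  congr 1
  ext j
  simp

end Norm

/-! ### Almost firmly nonexpansive mappings. -/

section Regularity

lemma psi_eq_norm_sq {V : Type*} [NormedAddCommGroup V] [InnerProductSpace ℝ V] (x y x' y' : V) :
    psi x y x' y' = ‖(x - x') - (y - y')‖ ^ 2 := by
  simp only [psi, ← real_inner_self_eq_norm_sq, inner_sub_left, inner_sub_right]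
  rw [real_inner_comm x x', real_inner_comm y x, real_inner_comm y' x, real_inner_comm y x',
    real_inner_comm y' x', real_inner_comm y' y]
  ring

lemma AlmostFirmlyNonexpansive.norm_sq_le {V : Type*} [NormedAddCommGroup V]
    [InnerProductSpace ℝ V] {G : Set V} {F : G → G} {α ε : ℝ}
    (h : AlmostFirmlyNonexpansive F α ε) (x y : G) :
    ‖(F x : V) - F y‖ ^ 2 ≤ (1 + ε) * ‖(x : V) - y‖ ^ 2
      - (1 - α) / α * ‖((x : V) - F x) - (y - F y)‖ ^ 2 := by
  rw [← psi_eq_norm_sq]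
  exact h x y

/-- Dropping the nonnegative discrepancy term leaves a Lipschitz bound with constant √(1 + ε). -/
lemma AlmostFirmlyNonexpansive.continuous {V : Type*} [NormedAddCommGroup V]
    [InnerProductSpace ℝ V] {G : Set V} {F : G → G} {α ε : ℝ}
    (h : AlmostFirmlyNonexpansive F α ε) (hα : α ∈ Set.Ioo (0 : ℝ) 1) (hε : 0 ≤ ε) :
    Continuous F := by
  refine LipschitzWith.continuous (K := Real.toNNReal √(1 + ε)) (LipschitzWith.of_dist_le_mul ?_)
  intro x y
  rw [Subtype.dist_eq, Subtype.dist_eq, dist_eq_norm, dist_eq_norm,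
    Real.coe_toNNReal _ (Real.sqrt_nonneg _)]
  have h1 := h.norm_sq_le x y
  have h2 : 0 ≤ (1 - α) / α * ‖((x : V) - F x) - (y - F y)‖ ^ 2 :=
    mul_nonneg (div_nonneg (by linarith [hα.2]) hα.1.le) (sq_nonneg _)
  refine le_of_sq_le_sq ?_ (by positivity)
  rw [mul_pow, Real.sq_sqrt (by linarith)]
  linarith

end Regularity

/-! ### Averaging over the random block. -/

section Block

variable {m : ℕ} {E : Fin m → Type*} {G : Set (PiLp 2 E)} {T : BlockIndex m → G → G}
  {η : Measure (BlockIndex m)}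

/-- The full index selects every block, so T_1 records all updates T'_j on G; every T_i is then
controlled by T_1. -/
lemma IsBlockwise.apply_eq [NeZero m] (hT : IsBlockwise T) (i : BlockIndex m) (x : G)
    (j : Fin m) : (T i x : PiLp 2 E) j =
      if j ∈ i.1 then (T (fullIndex m) x : PiLp 2 E) j else (x : PiLp 2 E) j := by
  obtain ⟨T', h⟩ := hT
  rw [h, h]
  simp [fullIndex]

variable [∀ j, NormedAddCommGroup (E j)]

lemma IsBlockwise.continuous [NeZero m] (hT : IsBlockwise T)
    (h : Continuous (T (fullIndex m))) (i : BlockIndex m) : Continuous (T i) := by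
  rw [continuous_induced_rng]
  refine (PiLp.homeomorph 2 E).isInducing.continuous_iff.2 (continuous_pi fun j => ?_)
  have hj : (fun x => (PiLp.homeomorph 2 E ∘ Subtype.val ∘ T i) x j) =
      fun x => if j ∈ i.1 then (T (fullIndex m) x : PiLp 2 E) j else (x : PiLp 2 E) j :=
    funext fun x => hT.apply_eq i x j
  rw [hj]
  split_ifs <;> fun_prop

lemma sum_real_singleton [IsProbabilityMeasure η] : ∑ i : BlockIndex m, η.real {i} = 1 := by
  rw [sum_measureReal_singleton]
  simp

/-- The expectation of a weighted sum of block terms that depend on whether the block is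
selected. -/
lemma sum_real_singleton_mul_ite [IsProbabilityMeasure η] (hη : ∀ j, 0 < blockProb η j)
    (a b : Fin m → ℝ) :
    ∑ i : BlockIndex m, η.real {i} * ∑ j, (1 / blockProb η j) * (if j ∈ i.1 then a j else b j) =
      ∑ j, a j + (∑ j, (1 / blockProb η j) * b j - ∑ j, b j) := by
  simp_rw [Finset.mul_sum]
  rw [Finset.sum_comm, ← Finset.sum_sub_distrib, ← Finset.sum_add_distrib]
  refine Finset.sum_congr rfl fun j _ => ?_
  have hj : ∀ i : BlockIndex m,
      η.real {i} * ((1 / blockProb η j) * (if j ∈ i.1 then a j else b j)) =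
        (1 / blockProb η j) * (a j - b j) * (η.real {i} * (if j ∈ i.1 then 1 else 0)) +
          (1 / blockProb η j) * b j * η.real {i} := by
    intro i
    split_ifs <;> ring
  simp_rw [hj]
  rw [Finset.sum_add_distrib, ← Finset.mul_sum, ← Finset.mul_sum, sum_real_singleton]
  -- The probabilities of the index sets containing j add up to p_j, which cancels the weight: block
  -- j contributes a_j + (1/p_j - 1) b_j.
  change 1 / blockProb η j * (a j - b j) * blockProb η j + _ = _
  have := (hη j).ne'
  field_simp
  ring

lemma blockProb_le_maxBlockProb (j : Fin m) : blockProb η j ≤ maxBlockProb η :=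
  le_ciSup (f := fun j => blockProb η j) (Set.finite_range _).bddAbove j

variable [∀ j, InnerProductSpace ℝ (E j)]

/-- The mean expansion of the squared weighted distance in one step, together with the mean
transport discrepancy. -/
lemma sum_wnorm_sq_add_sum_wpsi_le [NeZero m] [IsProbabilityMeasure η]
    (hη : ∀ j, 0 < blockProb η j) (hT : IsBlockwise T) {α ε : ℝ} (hε : 0 ≤ ε)
    (hT₁ : AlmostFirmlyNonexpansive (T (fullIndex m)) α ε) (x y : G) :
    ∑ i, η.real {i} * wnorm (blockProb η) ((T i x : PiLp 2 E) - (T i y : PiLp 2 E)) ^ 2 +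
      (1 - α) / α * ∑ i, η.real {i} * wpsi (blockProb η) (x : PiLp 2 E) y (T i x) (T i y) ≤
      (1 + maxBlockProb η * ε) * wnorm (blockProb η) ((x : PiLp 2 E) - (y : PiLp 2 E)) ^ 2 := by
  -- Unselected blocks keep x - y, hence the correction ‖x - y‖_p² - ‖x - y‖²; in `h2` they
  -- contribute nothing.
  have h1 : ∑ i, η.real {i} * wnorm (blockProb η) ((T i x : PiLp 2 E) - (T i y : PiLp 2 E)) ^ 2 =
      ‖(T (fullIndex m) x : PiLp 2 E) - (T (fullIndex m) y : PiLp 2 E)‖ ^ 2 +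
        (wnorm (blockProb η) ((x : PiLp 2 E) - (y : PiLp 2 E)) ^ 2 - ‖(x : PiLp 2 E) - (y : PiLp 2 E)‖ ^ 2) := by
    rw [wnorm_sq hη, PiLp.norm_sq_eq_of_L2, PiLp.norm_sq_eq_of_L2, ← sum_real_singleton_mul_ite hη]
    refine Finset.sum_congr rfl fun i _ => ?_
    rw [wnorm_sq hη]
    congr 1
    refine Finset.sum_congr rfl fun j _ => ?_
    rw [PiLp.sub_apply, hT.apply_eq i x, hT.apply_eq i y]
    split_ifs <;> rfl
  have h2 : ∑ i, η.real {i} * wpsi (blockProb η) (x : PiLp 2 E) y (T i x) (T i y) =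
      ‖((x : PiLp 2 E) - (T (fullIndex m) x : PiLp 2 E)) -
        ((y : PiLp 2 E) - (T (fullIndex m) y : PiLp 2 E))‖ ^ 2 := by
    rw [PiLp.norm_sq_eq_of_L2]
    have := sum_real_singleton_mul_ite hη (fun j =>
      ‖(((x : PiLp 2 E) - (T (fullIndex m) x : PiLp 2 E)) -
        ((y : PiLp 2 E) - (T (fullIndex m) y : PiLp 2 E))) j‖ ^ 2) (fun _ => 0)
    simp only [mul_zero, Finset.sum_const_zero, sub_zero, add_zero] at this
    rw [← this]
    refine Finset.sum_congr rfl fun i _ => ?_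
    rw [wpsi, wnorm_sq hη]
    congr 1
    refine Finset.sum_congr rfl fun j _ => ?_
    simp only [PiLp.sub_apply]
    rw [hT.apply_eq i x, hT.apply_eq i y]
    split_ifs <;> simp
  rw [h1, h2]
  have h3 := hT₁.norm_sq_le x y
  have h4 := mul_le_mul_of_nonneg_left
    (norm_sq_le_mul_wnorm_sq hη blockProb_le_maxBlockProb ((x : PiLp 2 E) - (y : PiLp 2 E))) hε
  linarith

/-- The same in terms of Lebesgue integrals. -/
lemma lintegral_wnorm_sq_add_lintegral_wpsi_le [NeZero m] [IsProbabilityMeasure η]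
    (hη : ∀ j, 0 < blockProb η j) (hT : IsBlockwise T) {α ε : ℝ} (hα : α ∈ Set.Ioo (0 : ℝ) 1)
    (hε : 0 ≤ ε) (hT₁ : AlmostFirmlyNonexpansive (T (fullIndex m)) α ε) (x y : G) :
    (∑ i, η {i} * ENNReal.ofReal (wnorm (blockProb η) ((T i x : PiLp 2 E) - (T i y : PiLp 2 E)) ^ 2)) +
      ENNReal.ofReal ((1 - α) / α) *
        ∫⁻ i, ENNReal.ofReal (wpsi (blockProb η) (x : PiLp 2 E) y (T i x) (T i y)) ∂η ≤
      ENNReal.ofReal (1 + maxBlockProb η * ε) *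
        ENNReal.ofReal (wnorm (blockProb η) ((x : PiLp 2 E) - (y : PiLp 2 E)) ^ 2) := by
  have hτ : 0 ≤ (1 - α) / α := div_nonneg (by linarith [hα.2]) hα.1.le
  have key : ∀ f : BlockIndex m → ℝ, (∀ i, 0 ≤ f i) →
      ∑ i, η {i} * ENNReal.ofReal (f i) = ENNReal.ofReal (∑ i, η.real {i} * f i) := by
    intro f hf
    rw [ENNReal.ofReal_sum_of_nonneg fun i _ => mul_nonneg measureReal_nonneg (hf i)]
    refine Finset.sum_congr rfl fun i _ => ?_
    rw [ENNReal.ofReal_mul measureReal_nonneg, ofReal_measureReal (measure_ne_top _ _)]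
  have hψ : ∀ i, 0 ≤ wpsi (blockProb η) (x : PiLp 2 E) y (T i x) (T i y) := fun i => sq_nonneg _
  rw [lintegral_fintype]
  simp_rw [mul_comm _ (η _)]
  rw [key _ fun i => sq_nonneg _, key _ hψ, ← ENNReal.ofReal_mul hτ,
    ← ENNReal.ofReal_add (Finset.sum_nonneg fun i _ => mul_nonneg measureReal_nonneg (sq_nonneg _))
      (mul_nonneg hτ (Finset.sum_nonneg fun i _ => mul_nonneg measureReal_nonneg (hψ i))),
    ← ENNReal.ofReal_mul']
  · exact ENNReal.ofReal_le_ofReal (sum_wnorm_sq_add_sum_wpsi_le hη hT hε hT₁ x y)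
  · exact sq_nonneg _

end Block

/-! ### Gluing of couplings. -/

section Gluing

/-- The gluing lemma: two measures with a common marginal are the marginals of a measure on the
triple product. -/
lemma exists_gluing {X Y Z : Type*} [MeasurableSpace X] [MeasurableSpace Y] [MeasurableSpace Z]
    [StandardBorelSpace Z] [Nonempty Z] (γ₁ : Measure (X × Y)) (γ₂ : Measure (Y × Z))
    [IsFiniteMeasure γ₁] [IsFiniteMeasure γ₂] (h : γ₁.map Prod.snd = γ₂.map Prod.fst) :
    ∃ Γ : Measure ((X × Y) × Z), Γ.map Prod.fst = γ₁ ∧ Γ.map (fun w => (w.1.2, w.2)) = γ₂ := by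
  -- Given (x, y) drawn from γ₁, draw z from the conditional law of γ₂ given y.
  refine ⟨γ₁.compProd (γ₂.condKernel.comap Prod.snd measurable_snd), Measure.fst_compProd _ _, ?_⟩
  have hm : Measurable (fun w : (X × Y) × Z => (w.1.2, w.2)) := by fun_prop
  conv_rhs => rw [← γ₂.disintegrate γ₂.condKernel, Measure.fst, ← h]
  refine Measure.ext fun s hs => ?_
  rw [Measure.map_apply hm hs, Measure.compProd_apply (hm hs), Measure.compProd_apply hs,
    lintegral_map (Kernel.measurable_kernel_prodMk_left hs) measurable_snd]
  rfl

end Gluing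

/-! ### The Wasserstein metric on a compact set. -/

section Wasserstein

variable {m : ℕ} {E : Fin m → Type*} {G : Set (PiLp 2 E)} {p : Fin m → ℝ}

lemma isProbabilityMeasure_of_mem_couplings [∀ j, MeasurableSpace (E j)]
    {μ ν : ProbabilityMeasure G} {γ : Measure (G × G)} (h : γ ∈ couplings μ ν) :
    IsProbabilityMeasure γ := by
  constructor
  have := congrArg (fun m : Measure G => m Set.univ) h.1
  simpa [Measure.map_apply measurable_fst MeasurableSet.univ] using this

variable [∀ j, NormedAddCommGroup (E j)]

lemma continuous_wnorm_sub (p : Fin m → ℝ) :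
    Continuous fun z : G × G => wnorm p ((z.1 : PiLp 2 E) - (z.2 : PiLp 2 E)) :=
  (continuous_wnorm p).comp (by fun_prop)

lemma exists_wnorm_sub_le [CompactSpace G] (p : Fin m → ℝ) :
    ∃ C : ℝ, ∀ z : G × G, wnorm p ((z.1 : PiLp 2 E) - (z.2 : PiLp 2 E)) ≤ C := by
  obtain ⟨C, hC⟩ := (isCompact_range (continuous_wnorm_sub (G := G) p)).bddAbove
  exact ⟨C, fun z => hC ⟨z, rfl⟩⟩

/-- The weighted distance, with values in the extended nonnegative reals. -/
noncomputable def wdist (p : Fin m → ℝ) (z : G × G) : ℝ≥0∞ :=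
  ENNReal.ofReal (wnorm p ((z.1 : PiLp 2 E) - (z.2 : PiLp 2 E)))

lemma wdist_swap (p : Fin m → ℝ) (z : G × G) : wdist p z.swap = wdist p z := by
  rw [wdist, wdist, wnorm_sub_comm]
  rfl

lemma ofReal_wnorm_sq (p : Fin m → ℝ) (z : G × G) :
    ENNReal.ofReal (wnorm p ((z.1 : PiLp 2 E) - (z.2 : PiLp 2 E)) ^ 2) = wdist p z ^ (2 : ℝ) := by
  rw [wdist, ENNReal.ofReal_pow (wnorm_nonneg _ _)]
  norm_cast

lemma wdist_triangle [∀ j, InnerProductSpace ℝ (E j)] (hp : ∀ j, 0 < p j) (x y z : G) :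
    wdist p (x, z) ≤ wdist p (x, y) + wdist p (y, z) := by
  rw [wdist, wdist, wdist, ← ENNReal.ofReal_add (wnorm_nonneg _ _) (wnorm_nonneg _ _)]
  refine ENNReal.ofReal_le_ofReal (le_trans (le_of_eq ?_) (wnorm_add_le hp _ _))
  simp

variable [∀ j, MeasurableSpace (E j)] {μ ν π : ProbabilityMeasure G}

lemma couplingCost_eq (p : Fin m → ℝ) (γ : Measure (G × G)) :
    couplingCost p γ = (∫⁻ z, wdist p z ^ (2 : ℝ) ∂γ) ^ (1 / 2 : ℝ) := by
  simp_rw [couplingCost, ofReal_wnorm_sq]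

lemma mem_P2 [CompactSpace G] (p : Fin m → ℝ) (μ : ProbabilityMeasure G) : μ ∈ P2 p G := by
  obtain ⟨C, hC⟩ := exists_wnorm_sub_le (G := G) p
  obtain ⟨x⟩ := μ.nonempty
  refine ⟨x, lt_of_le_of_lt (lintegral_mono (g := fun _ => ENNReal.ofReal C ^ (2 : ℝ))
    fun y => ?_) (by simp)⟩
  rw [ofReal_wnorm_sq p (x, y)]
  exact ENNReal.rpow_le_rpow (ENNReal.ofReal_le_ofReal (hC (x, y))) (by norm_num)

lemma W2_le_of_mem {γ : Measure (G × G)} (h : γ ∈ couplings μ ν) :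
    W2 p μ ν ≤ couplingCost p γ := iInf₂_le γ h

variable [∀ j, InnerProductSpace ℝ (E j)] [∀ j, FiniteDimensional ℝ (E j)]
  [∀ j, BorelSpace (E j)]

lemma measurable_wdist (p : Fin m → ℝ) : Measurable (wdist p : G × G → ℝ≥0∞) :=
  (ENNReal.continuous_ofReal.comp (continuous_wnorm_sub p)).measurable

lemma W2_comm_le (p : Fin m → ℝ) (μ ν : ProbabilityMeasure G) : W2 p μ ν ≤ W2 p ν μ := by
  refine le_iInf₂ fun γ hγ => ?_
  have hc : γ.map Prod.swap ∈ couplings μ ν :=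
    ⟨by rw [Measure.map_map measurable_fst measurable_swap]; exact hγ.2,
      by rw [Measure.map_map measurable_snd measurable_swap]; exact hγ.1⟩
  refine (W2_le_of_mem hc).trans (le_of_eq ?_)
  rw [couplingCost_eq, couplingCost_eq,
    lintegral_map ((measurable_wdist p).pow_const _) measurable_swap]
  simp_rw [wdist_swap]

lemma W2_comm (p : Fin m → ℝ) (μ ν : ProbabilityMeasure G) : W2 p μ ν = W2 p ν μ :=
  le_antisymm (W2_comm_le p μ ν) (W2_comm_le p ν μ)

variable [CompactSpace G]

lemma W2_ne_top (p : Fin m → ℝ) (μ ν : ProbabilityMeasure G) : W2 p μ ν ≠ ∞ := by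
  obtain ⟨C, hC⟩ := exists_wnorm_sub_le (G := G) p
  have hc : (μ : Measure G).prod (ν : Measure G) ∈ couplings μ ν := by
    constructor <;> simp
  refine ne_top_of_le_ne_top ?_ (W2_le_of_mem hc)
  rw [couplingCost_eq]
  refine ENNReal.rpow_ne_top_of_nonneg (by norm_num) (ne_top_of_le_ne_top ?_
    (lintegral_mono (g := fun _ => ENNReal.ofReal C ^ (2 : ℝ)) fun z => ?_))
  · simp
  · exact ENNReal.rpow_le_rpow (ENNReal.ofReal_le_ofReal (hC z)) (by norm_num)

/-- Limits of couplings along an ultrafilter are couplings of the limits, and the transport cost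
passes to the limit. -/
lemma exists_coupling_of_tendsto {ι : Type*} (U : Ultrafilter ι) {ν : ι → ProbabilityMeasure G}
    (hν : Tendsto ν U (𝓝 π)) {c : ι → ℝ≥0∞} {c₀ : ℝ≥0∞} (hc : Tendsto c U (𝓝 c₀))
    (h : ∀ i, W2 p μ (ν i) < c i) : ∃ γ ∈ couplings μ π, couplingCost p γ ≤ c₀ := by
  have h' : ∀ i, ∃ γ : Measure (G × G), γ ∈ couplings μ (ν i) ∧ couplingCost p γ < c i := by
    intro i
    have := h i
    simp only [W2, iInf_lt_iff] at this
    obtain ⟨γ, hγ, hlt⟩ := this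
    exact ⟨γ, hγ, hlt⟩
  choose γ hγ hcost using h'
  let γ' : ι → ProbabilityMeasure (G × G) :=
    fun i => ⟨γ i, isProbabilityMeasure_of_mem_couplings (hγ i)⟩
  -- Weak compactness of the probability measures on the compact space G × G.
  obtain ⟨Γ, -, hΓ⟩ := isCompact_univ.ultrafilter_le_nhds (U.map γ') (by simp)
  have hΓ : Tendsto γ' U (𝓝 Γ) := hΓ
  have h1 : Γ.map (f := Prod.fst) measurable_fst.aemeasurable = μ := by
    refine tendsto_nhds_unique
      (ProbabilityMeasure.tendsto_map_of_tendsto_of_continuous γ' Γ hΓ continuous_fst) ?_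
    refine tendsto_const_nhds.congr fun i => ?_
    exact Subtype.ext (hγ i).1.symm
  have h2 : Γ.map (f := Prod.snd) measurable_snd.aemeasurable = π := by
    refine tendsto_nhds_unique
      (ProbabilityMeasure.tendsto_map_of_tendsto_of_continuous γ' Γ hΓ continuous_snd) ?_
    refine hν.congr fun i => ?_
    exact Subtype.ext (hγ i).2.symm
  refine ⟨Γ, ⟨congrArg Subtype.val h1, congrArg Subtype.val h2⟩, ?_⟩
  -- The squared distance is bounded on G × G, hence a test function for weak convergence, and the
  -- cost converges.
  let f : BoundedContinuousFunction (G × G) ℝ≥0 := BoundedContinuousFunction.mkOfCompact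
    ⟨fun z => Real.toNNReal (wnorm p ((z.1 : PiLp 2 E) - (z.2 : PiLp 2 E)) ^ 2),
      continuous_real_toNNReal.comp ((continuous_wnorm_sub p).pow 2)⟩
  have h3 := (ProbabilityMeasure.tendsto_iff_forall_lintegral_tendsto.1 hΓ) f
  have h4 : Tendsto (fun i => couplingCost p (γ i)) U (𝓝 (couplingCost p (Γ : Measure (G × G)))) :=
    (ENNReal.continuous_rpow_const.tendsto _).comp h3
  exact le_of_tendsto_of_tendsto' h4 hc fun i => (hcost i).le

/-- The Wasserstein distance is attained. -/
lemma exists_optimalCoupling (p : Fin m → ℝ) (μ ν : ProbabilityMeasure G) :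
    (optimalCouplings p μ ν).Nonempty := by
  -- The added term makes the bound strict; it is ∞ at n = 0, which is harmless.
  have hc : Tendsto (fun n : ℕ => W2 p μ ν + (n : ℝ≥0∞)⁻¹) (hyperfilter ℕ) (𝓝 (W2 p μ ν)) := by
    have := (tendsto_const_nhds (x := W2 p μ ν)).add ENNReal.tendsto_inv_nat_nhds_zero
    rw [add_zero] at this
    exact this.mono_left Nat.hyperfilter_le_atTop
  obtain ⟨γ, hγ, hle⟩ := exists_coupling_of_tendsto (hyperfilter ℕ)
    (tendsto_const_nhds (x := ν)) hc fun n =>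
      ENNReal.lt_add_right (W2_ne_top p μ ν) (ENNReal.inv_ne_zero.2 (ENNReal.natCast_ne_top n))
  exact ⟨γ, hγ, le_antisymm hle (W2_le_of_mem hγ)⟩

lemma W2_triangle (hp : ∀ j, 0 < p j) (μ ν π : ProbabilityMeasure G) :
    W2 p μ π ≤ W2 p μ ν + W2 p ν π := by
  obtain ⟨γ₁, h₁, hW₁⟩ := exists_optimalCoupling p μ ν
  obtain ⟨γ₂, h₂, hW₂⟩ := exists_optimalCoupling p ν π
  have := isProbabilityMeasure_of_mem_couplings h₁
  have := isProbabilityMeasure_of_mem_couplings h₂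
  have := μ.nonempty
  obtain ⟨Γ, hΓ₁, hΓ₂⟩ := exists_gluing γ₁ γ₂ (h₁.2.trans h₂.1.symm)
  have hm₂ : Measurable fun w : (G × G) × G => (w.1.2, w.2) := by fun_prop
  have hm : Measurable fun w : (G × G) × G => (w.1.1, w.2) := by fun_prop
  have hΓ : Γ.map (fun w => (w.1.1, w.2)) ∈ couplings μ π := by
    constructor
    · rw [Measure.map_map measurable_fst hm, ← h₁.1, ← hΓ₁,
        Measure.map_map measurable_fst measurable_fst]
      rfl
    · rw [Measure.map_map measurable_snd hm, ← h₂.2, ← hΓ₂, Measure.map_map measurable_snd hm₂]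
      rfl
  have hd := measurable_wdist (G := G) p
  rw [← hW₁, ← hW₂]
  refine (W2_le_of_mem hΓ).trans ?_
  rw [couplingCost_eq, couplingCost_eq, couplingCost_eq, ← hΓ₁, ← hΓ₂,
    lintegral_map (hd.pow_const _) hm, lintegral_map (hd.pow_const _) hm₂,
    lintegral_map (hd.pow_const _) measurable_fst]
  refine le_trans ?_ (ENNReal.lintegral_Lp_add_le (hd.comp measurable_fst).aemeasurable
    (hd.comp hm₂).aemeasurable one_le_two)
  gcongr with w
  exact wdist_triangle hp w.1.1 w.1.2 w.2

/-- The Wasserstein distance is lower semicontinuous with respect to weak convergence. -/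
lemma W2_le_of_tendsto {ι : Type*} (U : Ultrafilter ι) {ν : ι → ProbabilityMeasure G}
    (hν : Tendsto ν U (𝓝 π)) {c : ι → ℝ≥0∞} {c₀ : ℝ≥0∞} (hc : Tendsto c U (𝓝 c₀))
    (h : ∀ᶠ i in U, W2 p μ (ν i) < c i) : W2 p μ π ≤ c₀ := by
  classical
  -- Replacing the bound by ∞ off the eventual set makes it hold for all indices without changing
  -- the limit.
  have hc' : Tendsto (fun i => if W2 p μ (ν i) < c i then c i else ∞) U (𝓝 c₀) :=
    hc.congr' (h.mono fun i hi => (if_pos hi).symm)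
  obtain ⟨γ, hγ, hle⟩ := exists_coupling_of_tendsto (p := p) (μ := μ) U hν hc' fun i => by
    split_ifs with hi
    · exact hi
    · exact (W2_ne_top p μ (ν i)).lt_top
  exact (W2_le_of_mem hγ).trans hle

end Wasserstein

/-! ### The Markov operator and its one-step inequality. -/

section Markov

variable {m : ℕ} {E : Fin m → Type*} [∀ j, MeasurableSpace (E j)]
  {G : Set (PiLp 2 E)} {η : Measure (BlockIndex m)}
  {T : BlockIndex m → G → G}

lemma transition_apply (x : G) {s : Set G} (hs : MeasurableSet s) :
    transition η T x s = ∑ i, η {i} * s.indicator 1 (T i x) := by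
  have hm : Measurable fun i => T i x := Measurable.of_discrete
  rw [transition, ← lintegral_indicator_one hs,
    lintegral_map (measurable_one.indicator hs) hm, lintegral_fintype]
  exact Finset.sum_congr rfl fun i _ => mul_comm _ _

/-- The index set is finite, so the operator is a finite mixture of push-forwards. -/
lemma markov_eq (hT : ∀ i, Measurable (T i)) (μ : Measure G) :
    markov η T μ = ∑ i, η {i} • μ.map (T i) := by
  have hm : Measurable (transition η T) := by
    refine Measure.measurable_of_measurable_coe _ fun s hs => ?_
    simp_rw [transition_apply _ hs]
    exact Finset.measurable_sum _ fun i _ =>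
      ((measurable_one.indicator hs).comp (hT i)).const_mul _
  refine Measure.ext fun s hs => ?_
  rw [markov, Measure.bind_apply hs hm.aemeasurable]
  have hi : ∀ i, Measurable fun x => s.indicator (1 : G → ℝ≥0∞) (T i x) := fun i =>
    (measurable_one.indicator hs).comp (hT i)
  simp_rw [transition_apply _ hs]
  rw [lintegral_finsetSum _ fun i _ => (hi i).const_mul _, Measure.finsetSum_apply]
  refine Finset.sum_congr rfl fun i _ => ?_
  rw [lintegral_const_mul _ (hi i), Measure.smul_apply,
    smul_eq_mul, ← lintegral_map (measurable_one.indicator hs) (hT i), lintegral_indicator_one hs]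

lemma lintegral_markov (hT : ∀ i, Measurable (T i)) (μ : Measure G) {f : G → ℝ≥0∞}
    (hf : Measurable f) : ∫⁻ x, f x ∂(markov η T μ) = ∑ i, η {i} * ∫⁻ x, f (T i x) ∂μ := by
  rw [markov_eq hT, lintegral_finsetSum_measure]
  refine Finset.sum_congr rfl fun i _ => ?_
  rw [lintegral_smul_measure, lintegral_map hf (hT i), smul_eq_mul]

/-- Applying the same random mapping to both components of a coupling. -/
lemma sum_smul_map_mem_couplings (hT : ∀ i, Measurable (T i)) {μ ν μ' ν' : ProbabilityMeasure G}
    (hμ : (μ' : Measure G) = markov η T μ) (hν : (ν' : Measure G) = markov η T ν)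
    {γ : Measure (G × G)} (hγ : γ ∈ couplings μ ν) :
    ∑ i, η {i} • γ.map (Prod.map (T i) (T i)) ∈ couplings μ' ν' := by
  constructor
  · rw [hμ, markov_eq hT, ← hγ.1, Measure.map_finset_sum measurable_fst.aemeasurable]
    refine Finset.sum_congr rfl fun i _ => ?_
    rw [Measure.map_smul, Measure.map_map measurable_fst ((hT i).prodMap (hT i)),
      Measure.map_map (hT i) measurable_fst]
    rfl
  · rw [hν, markov_eq hT, ← hγ.2, Measure.map_finset_sum measurable_snd.aemeasurable]
    refine Finset.sum_congr rfl fun i _ => ?_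
    rw [Measure.map_smul, Measure.map_map measurable_snd ((hT i).prodMap (hT i)),
      Measure.map_map (hT i) measurable_snd]
    rfl

variable [∀ j, NormedAddCommGroup (E j)] [∀ j, InnerProductSpace ℝ (E j)]
  [∀ j, FiniteDimensional ℝ (E j)] [∀ j, BorelSpace (E j)] [IsProbabilityMeasure η]

/-- The Markov operator is Feller, so that the set of invariant measures is weakly closed. -/
lemma isClosed_inv (hT : ∀ i, Continuous (T i)) : IsClosed (inv η T) := by
  have hcont : ∀ f : BoundedContinuousFunction G ℝ≥0,
      Continuous fun π : ProbabilityMeasure G => ∫⁻ x, f x ∂(π : Measure G) := fun f =>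
    continuous_iff_continuousAt.2 fun π =>
      ProbabilityMeasure.tendsto_iff_forall_lintegral_tendsto.1 tendsto_id f
  -- Invariance is tested on continuous f; both sides depend weakly continuously on π because each f
  -- ∘ T_i is again continuous.
  have heq : inv η T = ⋂ f : BoundedContinuousFunction G ℝ≥0, {π : ProbabilityMeasure G |
      ∑ i, η {i} * ∫⁻ x, f.compContinuous ⟨T i, hT i⟩ x ∂(π : Measure G) =
        ∫⁻ x, f x ∂(π : Measure G)} := by
    ext π
    simp only [inv, Set.mem_ofPred_eq, Set.mem_iInter]
    have hf : ∀ f : BoundedContinuousFunction G ℝ≥0,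
        ∑ i, η {i} * ∫⁻ x, f.compContinuous ⟨T i, hT i⟩ x ∂(π : Measure G) =
          ∫⁻ x, f x ∂(markov η T π) := fun f =>
      (lintegral_markov (fun i => (hT i).measurable) _
        (ENNReal.continuous_coe.comp f.continuous).measurable).symm
    refine ⟨fun h f => by rw [hf, h], fun h => ?_⟩
    refine (ext_of_forall_lintegral_eq_of_IsFiniteMeasure fun f => ?_).symm
    rw [← hf, h]
  rw [heq]
  refine isClosed_iInter fun f => isClosed_eq ?_ (hcont f)
  exact continuous_finsetSum _ fun i _ =>
    ENNReal.continuous_const_mul (measure_ne_top _ _) |>.comp (hcont _)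

variable [CompactSpace G] [NeZero m]

/-- One step of the Markov chain decreases the distance to an invariant measure by the transport
discrepancy, up to the violation. -/
lemma W2_sq_add_Psi_sq_le (hη : ∀ j, 0 < blockProb η j) (hT : IsBlockwise T) {α ε : ℝ}
    (hα : α ∈ Set.Ioo (0 : ℝ) 1) (hε : 0 ≤ ε)
    (hT₁ : AlmostFirmlyNonexpansive (T (fullIndex m)) α ε) {μ μ' π : ProbabilityMeasure G}
    (hμ : (μ' : Measure G) = markov η T μ) (hπ : π ∈ inv η T) :
    W2 (blockProb η) μ' π ^ 2 + ENNReal.ofReal ((1 - α) / α) * Psi η T μ ^ 2 ≤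
      ENNReal.ofReal (1 + maxBlockProb η * ε) * W2 (blockProb η) μ π ^ 2 := by
  have hTc := hT.continuous (hT₁.continuous hα hε)
  have hTm : ∀ i, Measurable (T i) := fun i => (hTc i).measurable
  have hsq : ∀ a : ℝ≥0∞, (a ^ (1 / 2 : ℝ)) ^ 2 = a := fun a => by
    rw [← ENNReal.rpow_natCast, ← ENNReal.rpow_mul]
    norm_num
  have hd := (measurable_wdist (G := G) (blockProb η)).pow_const (2 : ℝ)
  have hdT : ∀ i, Measurable fun z : G × G =>
      wdist (blockProb η) (T i z.1, T i z.2) ^ (2 : ℝ) := fun i =>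
    hd.comp ((hTm i).prodMap (hTm i))
  obtain ⟨γ, hγ, hγW⟩ := exists_optimalCoupling (blockProb η) μ π
  have hΨ : Psi η T μ ^ 2 ≤ ∫⁻ z : G × G, ∫⁻ i, ENNReal.ofReal (wpsi (blockProb η)
      (z.1 : PiLp 2 E) z.2 (T i z.1) (T i z.2)) ∂η ∂γ := by
    rw [← hsq (∫⁻ z : G × G, _ ∂γ)]
    gcongr
    -- The coupling that realizes d_W(μ, π) is itself admissible in the infimum defining Ψ.
    exact (iInf₂_le π hπ).trans (iInf₂_le γ ⟨hγ, hγW⟩)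
  have hW : W2 (blockProb η) μ' π ^ 2 ≤
      ∫⁻ z : G × G, ∑ i, η {i} * wdist (blockProb η) (T i z.1, T i z.2) ^ (2 : ℝ) ∂γ := by
    refine (pow_le_pow_left' (W2_le_of_mem
      (sum_smul_map_mem_couplings hTm hμ hπ.symm hγ)) 2).trans (le_of_eq ?_)
    rw [couplingCost_eq, hsq, lintegral_finsetSum_measure, lintegral_finsetSum _ fun i _ =>
      (hdT i).const_mul _]
    refine Finset.sum_congr rfl fun i _ => ?_
    rw [lintegral_smul_measure, lintegral_map hd ((hTm i).prodMap (hTm i)), smul_eq_mul,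
      lintegral_const_mul _ (hdT i)]
    rfl
  have hmeas : Measurable fun z : G × G =>
      ∑ i, η {i} * wdist (blockProb η) (T i z.1, T i z.2) ^ (2 : ℝ) :=
    Finset.measurable_sum _ fun i _ => (hdT i).const_mul _
  refine (add_le_add hW (mul_le_mul_right hΨ _)).trans ?_
  rw [← hγW, couplingCost_eq, hsq, ← lintegral_const_mul' _ _ ENNReal.ofReal_ne_top,
    ← lintegral_add_left hmeas, ← lintegral_const_mul' _ _ ENNReal.ofReal_ne_top]
  refine lintegral_mono fun z => ?_
  simp_rw [← ofReal_wnorm_sq]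
  exact lintegral_wnorm_sq_add_lintegral_wpsi_le hη hT hα hε hT₁ z.1 z.2

end Markov

/-! ### The laws of the iterates. -/

section Law

/-- The joint law of the triple is a product of three measures, which can be reassociated. -/
lemma IndepFun.prodMk_left_of_prodMk_right {Ω α β γ : Type*} [MeasurableSpace Ω]
    [MeasurableSpace α] [MeasurableSpace β] [MeasurableSpace γ] {P : Measure Ω}
    [IsProbabilityMeasure P] {X : Ω → α} {Y : Ω → β} {Z : Ω → γ} (hX : Measurable X)
    (hY : Measurable Y) (hZ : Measurable Z) (h : IndepFun X (fun ω => (Y ω, Z ω)) P)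
    (h' : IndepFun Y Z P) : IndepFun (fun ω => (X ω, Y ω)) Z P := by
  have hXY : IndepFun X Y P := h.comp measurable_id measurable_fst
  rw [indepFun_iff_map_prod_eq_prod_map_map (by fun_prop) (by fun_prop)] at *
  rw [hXY]
  have := Measure.isProbabilityMeasure_map (μ := P) hX.aemeasurable
  have := Measure.isProbabilityMeasure_map (μ := P) hY.aemeasurable
  have := Measure.isProbabilityMeasure_map (μ := P) hZ.aemeasurable
  apply (MeasurableEquiv.prodAssoc (α := α) (β := β) (γ := γ)).map_measurableEquiv_injective
  rw [Measure.prodAssoc_prod, ← h', ← h, Measure.map_map (by fun_prop) (by fun_prop)]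
  rfl

variable {m : ℕ} {E : Fin m → Type*} [∀ j, MeasurableSpace (E j)]
  {G : Set (PiLp 2 E)} {η : Measure (BlockIndex m)}
  {T : BlockIndex m → G → G} {Ω : Type*} [MeasurableSpace Ω] {P : Measure Ω}
  {ξ : ℕ → Ω → BlockIndex m} {X : ℕ → Ω → G}

lemma measurable_eval_of_countable {α ι β : Type*} [MeasurableSpace α] [MeasurableSpace ι]
    [Countable ι] [DiscreteMeasurableSpace ι] [MeasurableSpace β] {T : ι → α → β}
    (hT : ∀ i, Measurable (T i)) : Measurable fun z : ι × α => T z.1 z.2 :=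
  measurable_from_prod_countable_right hT

/-- The iterate is a measurable function of the initial state and of the past indices. -/
lemma IsStochasticBlockIteration.exists_eq (hX : IsStochasticBlockIteration P η T ξ X)
    (hT : ∀ i, Measurable (T i)) (k : ℕ) :
    ∃ F : G × (Finset.range k → BlockIndex m) → G, Measurable F ∧
      ∀ ω, X k ω = F (X 0 ω, fun i => ξ i ω) := by
  induction k with
  | zero => exact ⟨Prod.fst, measurable_fst, fun ω => rfl⟩
  | succ k ih =>
    obtain ⟨F, hF, h⟩ := ih
    have hk : ∀ i : Finset.range k, (i : ℕ) ∈ Finset.range (k + 1) := fun i =>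
      Finset.range_subset_range.2 k.le_succ i.2
    refine ⟨fun z => T (z.2 ⟨k, Finset.self_mem_range_succ k⟩) (F (z.1, fun i => z.2 ⟨i, hk i⟩)),
      ?_, fun ω => ?_⟩
    · exact (measurable_eval_of_countable hT).comp
        (Measurable.prodMk (by fun_prop) (hF.comp (by fun_prop)))
    · rw [hX.step, h]

lemma IsStochasticBlockIteration.indepFun [IsProbabilityMeasure P]
    (hX : IsStochasticBlockIteration P η T ξ X) (hT : ∀ i, Measurable (T i)) (k : ℕ) :
    IndepFun (X k) (ξ k) P := by
  obtain ⟨F, hF, h⟩ := hX.exists_eq hT k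
  have h1 : IndepFun (fun ω (i : Finset.range k) => ξ i ω) (ξ k) P :=
    (hX.indep_index.indepFun_finset (Finset.range k) {k} (by simp) hX.measurable_index).comp
      (φ := id) (ψ := fun y : ({k} : Finset ℕ) → BlockIndex m => y ⟨k, Finset.mem_singleton_self k⟩)
      measurable_id (measurable_pi_apply _)
  have h2 : IndepFun (X 0) (fun ω => ((fun i : Finset.range k => ξ i ω), ξ k ω)) P :=
    hX.indep_init.comp (φ := id)
      (ψ := fun y : ℕ → BlockIndex m => ((fun i : Finset.range k => y i), y k))
      measurable_id (by fun_prop)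
  have hm := hX.measurable_index
  have h3 := IndepFun.prodMk_left_of_prodMk_right hX.measurable_init
    (by fun_prop) (hm k) h2 h1
  rw [show X k = F ∘ fun ω => (X 0 ω, fun i => ξ i ω) from funext h]
  exact h3.comp hF measurable_id

lemma IsStochasticBlockIteration.measurable (hX : IsStochasticBlockIteration P η T ξ X)
    (hT : ∀ i, Measurable (T i)) (k : ℕ) : Measurable (X k) := by
  induction k with
  | zero => exact hX.measurable_init
  | succ k ih =>
    rw [funext (hX.step k)]
    exact (measurable_eval_of_countable hT).comp ((hX.measurable_index k).prodMk ih)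

/-- The laws of the iterates are obtained by iterating the Markov operator. -/
lemma IsStochasticBlockIteration.map_succ [IsProbabilityMeasure P]
    (hX : IsStochasticBlockIteration P η T ξ X) (hT : ∀ i, Measurable (T i)) (k : ℕ) :
    P.map (X (k + 1)) = markov η T (P.map (X k)) := by
  have hXm := hX.measurable hT
  refine Measure.ext fun s hs => ?_
  -- Split the event by the value of ξ_k, which is independent of X_k.
  have hu : X (k + 1) ⁻¹' s = ⋃ i, (X k ⁻¹' (T i ⁻¹' s)) ∩ (ξ k ⁻¹' {i}) := by
    ext ω
    simp [hX.step]
  rw [markov_eq hT, Measure.finsetSum_apply, Measure.map_apply (hXm _) hs, hu,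
    measure_iUnion, tsum_fintype]
  · refine Finset.sum_congr rfl fun i _ => ?_
    rw [(hX.indepFun hT k).measure_inter_preimage_eq_mul _ _ (hT i hs)
      (measurableSet_singleton i), Measure.smul_apply, smul_eq_mul, Measure.map_apply (hT i) hs,
      Measure.map_apply (hXm k) (hT i hs), ← hX.law_index k,
      Measure.map_apply (hX.measurable_index k) (measurableSet_singleton i), mul_comm]
  · intro i j hij
    refine Set.disjoint_left.2 fun ω h1 h2 => hij ?_
    exact h1.2.symm.trans h2.2
  · exact fun i => (hXm k (hT i hs)).inter (hX.measurable_index k (measurableSet_singleton i))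

end Law

/-! ### Gauges and scalar recursions. -/

section Gauge

variable {ρ θ : ℝ≥0 → ℝ≥0} {τ ε : ℝ}

/-- The relation exhibits a preimage s(t) of every t under ρ, so ρ is an order isomorphism with
continuous inverse s, and θ(t)² = (1 + ε)t² - τ s(t)². -/
lemma GaugeRelation.continuous (hρ : IsGauge ρ) (hτ : 0 < τ) (h : GaugeRelation τ ε ρ θ) :
    Continuous θ := by
  let s : ℝ≥0 → ℝ≥0 := fun t => Real.toNNReal √(((1 + ε) * (t : ℝ) ^ 2 - (θ t : ℝ) ^ 2) / τ)
  let e : ℝ≥0 ≃o ℝ≥0 := hρ.strictMono.orderIsoOfSurjective ρ fun t => ⟨s t, (h t).2⟩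
  have hs : Continuous s := by
    have : s = e.symm := funext fun t => (e.eq_symm_apply).2 (h t).2
    rw [this]
    exact e.symm.continuous
  have hθ : θ = fun t : ℝ≥0 => Real.toNNReal √((1 + ε) * (t : ℝ) ^ 2 - τ * (s t : ℝ) ^ 2) := by
    funext t
    have h1 : 0 ≤ (1 + ε) * (t : ℝ) ^ 2 - (θ t : ℝ) ^ 2 := sub_nonneg.2 (h t).1
    rw [Real.coe_toNNReal _ (Real.sqrt_nonneg _), Real.sq_sqrt (by positivity),
      mul_div_cancel₀ _ hτ.ne', sub_sub_cancel, Real.sqrt_sq (NNReal.coe_nonneg _),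
      Real.toNNReal_coe]
  rw [hθ]
  fun_prop

/-- The sequence decreases to some L; continuity gives L ≤ θ(L), which is impossible for 0 < L ≤ b.
-/
lemma tendsto_zero_of_le_comp {t : ℕ → ℝ≥0} {b : ℝ≥0} (hθ : Continuous θ) (h₀ : t 0 ≤ b)
    (hlt : ∀ s ∈ Set.Ioc 0 b, θ s < s) (hz : θ 0 = 0) (ht : ∀ k, t (k + 1) ≤ θ (t k)) :
    Tendsto t atTop (𝓝 0) := by
  have hle : ∀ s ≤ b, θ s ≤ s := fun s hs => by
    rcases eq_or_ne s 0 with rfl | h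
    · exact hz.le
    · exact (hlt s ⟨pos_iff_ne_zero.2 h, hs⟩).le
  have hb : ∀ k, t k ≤ b := fun k => by
    induction k with
    | zero => exact h₀
    | succ k ih => exact (ht k).trans ((hle _ ih).trans ih)
  have hanti : Antitone t := antitone_nat_of_succ_le fun k => (ht k).trans (hle _ (hb k))
  have hlim := tendsto_atTop_ciInf hanti (OrderBot.bddBelow _)
  have hfix : ⨅ k, t k ≤ θ (⨅ k, t k) :=
    le_of_tendsto_of_tendsto' (hlim.comp (tendsto_add_atTop_nat 1))
      ((hθ.tendsto _).comp hlim) ht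
  have h0 : ⨅ k, t k = 0 := by
    by_contra hne
    exact absurd (hlt _ ⟨pos_iff_ne_zero.2 hne, (ciInf_le (OrderBot.bddBelow _) 0).trans h₀⟩)
      hfix.not_gt
  rwa [h0] at hlim

lemma iterate_le {b t₀ : ℝ≥0} (h₀ : t₀ ≤ b) (hle : ∀ s ≤ b, θ s ≤ s) (k : ℕ) :
    θ^[k] t₀ ≤ b := by
  induction k with
  | zero => exact h₀
  | succ k ih =>
    rw [Function.iterate_succ_apply']
    exact (hle _ ih).trans ih

lemma le_iterate_of_le_comp {t : ℕ → ℝ≥0} {b : ℝ≥0} (h₀ : t 0 ≤ b)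
    (hle : ∀ s ≤ b, θ s ≤ s) (hmono : MonotoneOn θ (Set.Icc 0 b))
    (ht : ∀ k, t (k + 1) ≤ θ (t k)) (k : ℕ) : t k ≤ θ^[k] (t 0) := by
  induction k with
  | zero => exact le_rfl
  | succ k ih =>
    have hb := iterate_le h₀ hle k
    rw [Function.iterate_succ_apply']
    exact (ht k).trans (hmono ⟨zero_le, ih.trans hb⟩ ⟨zero_le, hb⟩ ih)

end Gauge

/-! ### From Cauchy rates to convergence. -/

section Convergence

variable {m : ℕ} {E : Fin m → Type*} [∀ j, NormedAddCommGroup (E j)]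
  [∀ j, InnerProductSpace ℝ (E j)] [∀ j, FiniteDimensional ℝ (E j)] [∀ j, MeasurableSpace (E j)]
  [∀ j, BorelSpace (E j)] {G : Set (PiLp 2 E)} [CompactSpace G] {p : Fin m → ℝ}
  {S : Set (ProbabilityMeasure G)}

lemma W2dist_ne_top (hS : S.Nonempty) (μ : ProbabilityMeasure G) : W2dist p μ S ≠ ∞ := by
  obtain ⟨π, hπ⟩ := hS
  exact ne_top_of_le_ne_top (W2_ne_top p μ π) (iInf₂_le π hπ)

lemma exists_W2_lt (hS : S.Nonempty) (μ : ProbabilityMeasure G) (n : ℕ) :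
    ∃ π ∈ S, W2 p μ π < W2dist p μ S + (n : ℝ≥0∞)⁻¹ := by
  have := ENNReal.lt_add_right (W2dist_ne_top (p := p) hS μ)
    (ENNReal.inv_ne_zero.2 (ENNReal.natCast_ne_top n))
  conv_lhs at this => rw [W2dist]
  simp only [iInf_lt_iff] at this
  obtain ⟨π, hπ, h⟩ := this
  exact ⟨π, hπ, h⟩

/-- A minimizing sequence for the distance to a set. -/
lemma exists_seq_tendsto_W2dist (hS : S.Nonempty) (μ : ProbabilityMeasure G) :
    ∃ π : ℕ → ProbabilityMeasure G, (∀ n, π n ∈ S) ∧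
      Tendsto (fun n => W2 p μ (π n)) atTop (𝓝 (W2dist p μ S)) := by
  choose π hπ hlt using exists_W2_lt (p := p) hS μ
  refine ⟨π, hπ, tendsto_of_tendsto_of_tendsto_of_le_of_le tendsto_const_nhds ?_
    (fun n => iInf₂_le (π n) (hπ n)) fun n => (hlt n).le⟩
  simpa using (tendsto_const_nhds (x := W2dist p μ S)).add ENNReal.tendsto_inv_nat_nhds_zero

/-- A sequence with Cauchy rate `r` that approaches a weakly closed set converges to a point of
that set with rate `r`. -/
lemma exists_forall_W2_le (hp : ∀ j, 0 < p j) (hS : S.Nonempty) (hSc : IsClosed S)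
    {μ : ℕ → ProbabilityMeasure G} {r : ℕ → ℝ≥0∞}
    (hr : ∀ k n, k < n → W2 p (μ k) (μ n) ≤ r k)
    (h0 : Tendsto (fun n => W2dist p (μ n) S) atTop (𝓝 0)) :
    ∃ π ∈ S, ∀ k, W2 p (μ k) π ≤ r k := by
  choose π hπ hlt using fun n => exists_W2_lt (p := p) hS (μ n) n
  obtain ⟨π₀, hπ₀, hle⟩ := hSc.isCompact.ultrafilter_le_nhds ((hyperfilter ℕ).map π)
    (by
      rw [Ultrafilter.coe_map, le_principal_iff]
      exact Eventually.of_forall (f := (hyperfilter ℕ).toFilter) hπ)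
  have hlim : Tendsto π (hyperfilter ℕ) (𝓝 π₀) := hle
  refine ⟨π₀, hπ₀, fun k => ?_⟩
  have hc : Tendsto (fun n : ℕ => r k + (W2dist p (μ n) S + (n : ℝ≥0∞)⁻¹)) (hyperfilter ℕ)
      (𝓝 (r k)) := by
    have := (tendsto_const_nhds (x := r k)).add (h0.add ENNReal.tendsto_inv_nat_nhds_zero)
    rw [add_zero, add_zero] at this
    exact this.mono_left Nat.hyperfilter_le_atTop
  -- The candidate limit is a weak limit of near-projections π_n of μ_n onto S; the rate survives
  -- since d_W(μ_n, π_n) tends to 0.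
  refine W2_le_of_tendsto (hyperfilter ℕ) hlim hc ?_
  filter_upwards [Nat.hyperfilter_le_atTop (eventually_gt_atTop k)] with n hn
  exact (W2_triangle hp _ (μ n) _).trans_lt
    (ENNReal.add_lt_add_of_le_of_lt (W2_ne_top _ _ _) (hr k n hn) (hlt n))

/-- Pass through a near-projection π of μ_k onto S: by Fejér monotonicity μ_n is no farther from π
than μ_k is. -/
lemma W2_le_two_mul_W2dist (hp : ∀ j, 0 < p j) (hS : S.Nonempty)
    {μ : ℕ → ProbabilityMeasure G}
    (hμ : ∀ k, ∀ π ∈ S, W2 p (μ (k + 1)) π ≤ W2 p (μ k) π) (k n : ℕ) (hkn : k < n) :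
    W2 p (μ k) (μ n) ≤ 2 * W2dist p (μ k) S := by
  obtain ⟨π, hπ, hlim⟩ := exists_seq_tendsto_W2dist (p := p) hS (μ k)
  refine ge_of_tendsto' (ENNReal.Tendsto.const_mul hlim (Or.inr (by simp))) fun i => ?_
  refine (W2_triangle hp _ (π i) _).trans ?_
  rw [two_mul, W2_comm p (π i)]
  gcongr
  exact antitone_nat_of_succ_le (f := fun k => W2 p (μ k) (π i)) (fun k => hμ k _ (hπ i)) hkn.le

lemma W2_le_tsum (hp : ∀ j, 0 < p j) {μ : ℕ → ProbabilityMeasure G} {d : ℕ → ℝ≥0}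
    (hd : Summable d) (hμ : ∀ k, W2 p (μ k) (μ (k + 1)) ≤ 2 * d k) (k n : ℕ) (hkn : k < n) :
    W2 p (μ k) (μ n) ≤ 2 * ((∑' j, d (k + j) : ℝ≥0) : ℝ≥0∞) := by
  have h : ∀ i, W2 p (μ k) (μ (k + (i + 1))) ≤
      2 * ((∑ j ∈ Finset.range (i + 1), d (k + j) : ℝ≥0) : ℝ≥0∞) := by
    intro i
    induction i with
    | zero => simpa using hμ k
    | succ i ih =>
      rw [Finset.sum_range_succ, ENNReal.coe_add, mul_add]
      exact (W2_triangle hp _ (μ (k + (i + 1))) _).trans (add_le_add ih (hμ _))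
  obtain ⟨i, rfl⟩ := Nat.exists_eq_add_of_lt hkn
  refine (h i).trans ?_
  gcongr
  exact (((NNReal.summable_nat_add_iff k).2 hd).congr fun j => by rw [add_comm]).sum_le_tsum _
    fun _ _ => zero_le

end Convergence

/-! ### One-step estimates under subregularity. -/

section Step

variable {m : ℕ} [NeZero m] {E : Fin m → Type*} [∀ j, NormedAddCommGroup (E j)]
  [∀ j, InnerProductSpace ℝ (E j)] [∀ j, FiniteDimensional ℝ (E j)] [∀ j, MeasurableSpace (E j)]
  [∀ j, BorelSpace (E j)] {G : Set (PiLp 2 E)} [CompactSpace G] {η : Measure (BlockIndex m)}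
  [IsProbabilityMeasure η] {T : BlockIndex m → G → G} {α ε : ℝ} {ρ θ : ℝ≥0 → ℝ≥0}
  {μ μ' : ProbabilityMeasure G}

/-- Under metric subregularity, the transport discrepancy in one step of the chain is bounded
below in terms of the distance to the set of invariant measures. -/
lemma W2_toReal_sq_le (hη : ∀ j, 0 < blockProb η j) (hT : IsBlockwise T)
    (hα : α ∈ Set.Ioo (0 : ℝ) 1) (hε : 0 ≤ ε)
    (hT₁ : AlmostFirmlyNonexpansive (T (fullIndex m)) α ε)
    (hρ : IsGauge ρ)
    (hρθ : GaugeRelation ((1 - α) / α) (maxBlockProb η * ε) ρ θ)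
    (hΨ : GaugeMetricallySubregular η T ρ) (hμ : (μ' : Measure G) = markov η T μ)
    {t : ℝ≥0} (ht : W2dist (blockProb η) μ (inv η T) = t)
    {π : ProbabilityMeasure G} (hπ : π ∈ inv η T) :
    (W2 (blockProb η) μ' π).toReal ^ 2 ≤ (1 + maxBlockProb η * ε) *
      ((W2 (blockProb η) μ π).toReal ^ 2 - (t : ℝ) ^ 2) + (θ t : ℝ) ^ 2 := by
  have hτ : 0 < (1 - α) / α := div_pos (by linarith [hα.2]) hα.1
  have hp : 0 ≤ 1 + maxBlockProb η * ε := by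
    have := (hη 0).le.trans (blockProb_le_maxBlockProb 0)
    positivity
  have hstep := W2_sq_add_Psi_sq_le hη hT hα hε hT₁ hμ hπ
  lift W2 (blockProb η) μ' π to ℝ≥0 using W2_ne_top _ _ _ with a
  lift W2 (blockProb η) μ π to ℝ≥0 using W2_ne_top _ _ _ with b
  -- Subregularity speaks only of finite Ψ(μ); finiteness follows from the one-step inequality, as τ
  -- > 0.
  have hΨt : Psi η T μ ≠ ∞ := by
    intro h
    rw [h, ENNReal.top_pow two_ne_zero, ENNReal.mul_top (by simpa using hτ), add_top,
      top_le_iff] at hstep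
    exact ENNReal.mul_ne_top ENNReal.ofReal_ne_top (by simp) hstep
  obtain ⟨h1, h2⟩ := hΨ μ (mem_P2 _ _)
  have hr := h2 _ (ENNReal.coe_toNNReal hΨt).symm
  rw [← ENNReal.coe_toNNReal hΨt] at hstep
  rw [← h1, ht, ENNReal.coe_le_coe] at hr
  set r := (Psi η T μ).toNNReal
  obtain ⟨hθ, hs⟩ := hρθ t
  -- Writing t as ρ(s) turns t ≤ ρ(Ψ(μ)) into s ≤ Ψ(μ), the lower bound on the discrepancy.
  rw [← hs, hρ.strictMono.le_iff_le] at hr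
  have hs2 := pow_le_pow_left₀ (NNReal.coe_nonneg _) (NNReal.coe_le_coe.2 hr) 2
  rw [Real.coe_toNNReal _ (Real.sqrt_nonneg _),
    Real.sq_sqrt (div_nonneg (sub_nonneg.2 hθ) hτ.le), div_le_iff₀' hτ] at hs2
  have hstep' := ENNReal.toReal_mono (ENNReal.mul_ne_top ENNReal.ofReal_ne_top (by simp)) hstep
  rw [ENNReal.toReal_add (by simp) (ENNReal.mul_ne_top ENNReal.ofReal_ne_top (by simp))] at hstep'
  simp only [ENNReal.toReal_mul, ENNReal.toReal_pow, ENNReal.coe_toReal,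
    ENNReal.toReal_ofReal hτ.le, ENNReal.toReal_ofReal hp] at hstep' ⊢
  linarith

/-- The one-step estimates for the distance to the set of invariant measures and for the step
length. -/
lemma W2dist_le_and_W2_le (hη : ∀ j, 0 < blockProb η j) (hT : IsBlockwise T)
    (hα : α ∈ Set.Ioo (0 : ℝ) 1) (hε : 0 ≤ ε)
    (hT₁ : AlmostFirmlyNonexpansive (T (fullIndex m)) α ε)
    (hinv : (inv η T).Nonempty) (hρ : IsGauge ρ)
    (hρθ : GaugeRelation ((1 - α) / α) (maxBlockProb η * ε) ρ θ)
    (hΨ : GaugeMetricallySubregular η T ρ) (hμ : (μ' : Measure G) = markov η T μ)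
    {t : ℝ≥0} (ht : W2dist (blockProb η) μ (inv η T) = t) :
    W2dist (blockProb η) μ' (inv η T) ≤ θ t ∧ W2 (blockProb η) μ μ' ≤ t + θ t := by
  obtain ⟨π, hπ, hlim⟩ := exists_seq_tendsto_W2dist (p := blockProb η) hinv μ
  rw [ht] at hlim
  have hreal : Tendsto (fun n => (W2 (blockProb η) μ (π n)).toReal) atTop (𝓝 (t : ℝ)) :=
    (ENNReal.tendsto_toReal ENNReal.coe_ne_top).comp hlim
  -- Along a minimizing sequence d_W(μ, π_n)² - t² vanishes, so no nearest invariant measure is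
  -- needed.
  have hbound : Tendsto (fun n => ENNReal.ofReal √((1 + maxBlockProb η * ε) *
      ((W2 (blockProb η) μ (π n)).toReal ^ 2 - (t : ℝ) ^ 2) + (θ t : ℝ) ^ 2)) atTop
      (𝓝 (θ t : ℝ≥0∞)) := by
    have := ENNReal.tendsto_ofReal (((((hreal.pow 2).sub_const ((t : ℝ) ^ 2)).const_mul
      (1 + maxBlockProb η * ε)).add_const ((θ t : ℝ) ^ 2)).sqrt)
    simpa using this
  have hle : ∀ n, W2 (blockProb η) μ' (π n) ≤ ENNReal.ofReal √((1 + maxBlockProb η * ε) *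
      ((W2 (blockProb η) μ (π n)).toReal ^ 2 - (t : ℝ) ^ 2) + (θ t : ℝ) ^ 2) := by
    intro n
    rw [← ENNReal.ofReal_toReal (W2_ne_top (blockProb η) μ' (π n))]
    exact ENNReal.ofReal_le_ofReal (Real.le_sqrt_of_sq_le
      (W2_toReal_sq_le hη hT hα hε hT₁ hρ hρθ hΨ hμ ht (hπ n)))
  refine ⟨ge_of_tendsto' hbound fun n => (iInf₂_le (π n) (hπ n)).trans (hle n),
    ge_of_tendsto' (hlim.add hbound) fun n => ?_⟩
  refine (W2_triangle hη _ (π n) _).trans ?_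
  rw [W2_comm _ (π n)]
  gcongr
  exact hle n

end Step

end StochasticBlock

/-! ### The theorem. -/

open StochasticBlock in
theorem theorem4p2
    {m : ℕ} [NeZero m] {E : Fin m → Type*}
    [∀ j, NormedAddCommGroup (E j)] [∀ j, InnerProductSpace ℝ (E j)]
    [∀ j, FiniteDimensional ℝ (E j)] [∀ j, MeasurableSpace (E j)] [∀ j, BorelSpace (E j)]
    (G : Set (PiLp 2 E)) (hG : IsCompact G)
    -- the law of the random index; every block is selected with positive probability
    (η : Measure (BlockIndex m)) [IsProbabilityMeasure η] (hη : ∀ j, 0 < blockProb η j)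
    -- blockwise self-mappings of `G`, with `T_1` almost firmly nonexpansive
    (T : BlockIndex m → G → G) (hT : IsBlockwise T)
    (α ε : ℝ) (hα : α ∈ Set.Ioo (0 : ℝ) 1) (hε : ε ∈ Set.Ico (0 : ℝ) 1)
    (hT₁ : AlmostFirmlyNonexpansive (T (fullIndex m)) α ε)
    (hinv : (inv η T ∩ P2 (blockProb η) G).Nonempty)
    -- metric subregularity with gauge `ρ` given in terms of `θ`
    (ρ θ : ℝ≥0 → ℝ≥0) (hρ : IsGauge ρ)
    (hρθ : GaugeRelation ((1 - α) / α) (maxBlockProb η * ε) ρ θ)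
    (hΨ : GaugeMetricallySubregular η T ρ)
    -- the iterates `X k` and their laws `μ k`
    {Ω : Type*} [MeasurableSpace Ω] (P : Measure Ω) [IsProbabilityMeasure P]
    (ξ : ℕ → Ω → BlockIndex m) (X : ℕ → Ω → G)
    (hX : IsStochasticBlockIteration P η T ξ X)
    (μ : ℕ → ProbabilityMeasure G) (hμ : ∀ k, (μ k : Measure G) = P.map (X k))
    (hμ₀ : μ 0 ∈ P2 (blockProb η) G) :
    (∀ k, W2dist (blockProb η) (μ k) (inv η T) ≠ ∞ ∧
      W2dist (blockProb η) (μ (k + 1)) (inv η T) ≤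
        θ (W2dist (blockProb η) (μ k) (inv η T)).toNNReal) ∧
    ∀ t₀ : ℝ≥0, W2dist (blockProb η) (μ 0) (inv η T) = t₀ →
    ∀ tbar : ℝ≥0, t₀ < tbar → θ 0 = 0 → (∀ t ∈ Set.Ioc 0 tbar, 0 < θ t ∧ θ t < t) →
      -- Fejér monotone case
      (((∀ t ∈ Set.Ioo 0 tbar, Tendsto (fun k => θ^[k] t) atTop (𝓝 0)) ∧
        (∀ k, ∀ π ∈ inv η T ∩ P2 (blockProb η) G,
          W2 (blockProb η) (μ (k + 1)) π ≤ W2 (blockProb η) (μ k) π)) →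
        ∃ π ∈ inv η T ∩ P2 (blockProb η) G,
          Tendsto (fun k => W2 (blockProb η) (μ k) π) atTop (𝓝 0) ∧
          (MonotoneOn θ (Set.Icc 0 tbar) →
            ∃ C : ℝ≥0, ∀ k, W2 (blockProb η) (μ k) π ≤ C * (θ^[k] t₀ : ℝ≥0))) ∧
      -- summable case
      ((∀ t ∈ Set.Ioo 0 tbar, Summable (fun j => θ^[j] t)) → MonotoneOn θ (Set.Icc 0 tbar) →
        ∃ π ∈ inv η T ∩ P2 (blockProb η) G,
          Tendsto (fun k => W2 (blockProb η) (μ k) π) atTop (𝓝 0) ∧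
          ∃ C : ℝ≥0, ∀ k,
            W2 (blockProb η) (μ k) π ≤ C * ((∑' j, θ^[k + j] t₀ : ℝ≥0) : ℝ≥0∞)) := by
  have : CompactSpace G := isCompact_iff_compactSpace.1 hG
  have hinv' : (inv η T).Nonempty := hinv.mono Set.inter_subset_left
  have hTc := hT.continuous (hT₁.continuous hα hε.1)
  have hstep : ∀ k, (μ (k + 1) : Measure G) = markov η T (μ k) := fun k => by
    rw [hμ, hμ, hX.map_succ (fun i => (hTc i).measurable)]
  have hdist : ∀ k, W2dist (blockProb η) (μ k) (inv η T) ≠ ∞ := fun k => W2dist_ne_top hinv' _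
  have hone := fun k => W2dist_le_and_W2_le hη hT hα hε.1 hT₁ hinv' hρ hρθ hΨ (hstep k)
    (ENNReal.coe_toNNReal (hdist k)).symm
  refine ⟨fun k => ⟨hdist k, (hone k).1⟩, fun t₀ ht₀ tbar htbar hθ0 hθ => ?_⟩
  set t : ℕ → ℝ≥0 := fun k => (W2dist (blockProb η) (μ k) (inv η T)).toNNReal with ht
  have htW : ∀ k, W2dist (blockProb η) (μ k) (inv η T) = t k := fun k =>
    (ENNReal.coe_toNNReal (hdist k)).symm
  have ht0 : t 0 = t₀ := by simp [ht, ht₀]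
  have hle : ∀ s ≤ tbar, θ s ≤ s := fun s hs => by
    rcases eq_or_ne s 0 with rfl | h
    · exact hθ0.le
    · exact (hθ s ⟨pos_iff_ne_zero.2 h, hs⟩).2.le
  have ht_succ : ∀ k, t (k + 1) ≤ θ (t k) := fun k => by
    have := (hone k).1
    rwa [htW, ENNReal.coe_le_coe] at this
  have ht_lim : Tendsto t atTop (𝓝 0) :=
    tendsto_zero_of_le_comp (hρθ.continuous hρ (div_pos (by linarith [hα.2]) hα.1))
      (ht0.trans_le htbar.le) (fun s hs => (hθ s hs).2) hθ0 ht_succ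
  have hW_lim : Tendsto (fun k => W2dist (blockProb η) (μ k) (inv η T)) atTop (𝓝 0) := by
    simp_rw [htW]
    exact ENNReal.tendsto_coe.2 ht_lim
  have ht_iter : MonotoneOn θ (Set.Icc 0 tbar) → ∀ k, t k ≤ θ^[k] t₀ := fun hmono k => by
    rw [← ht0]
    exact le_iterate_of_le_comp (ht0.trans_le htbar.le) hle hmono ht_succ k
  constructor
  · rintro ⟨-, hfejer⟩
    obtain ⟨π, hπ, hπW⟩ := exists_forall_W2_le hη hinv' (isClosed_inv hTc)
      (W2_le_two_mul_W2dist hη hinv' fun k π hπ => hfejer k π ⟨hπ, mem_P2 _ _⟩) hW_lim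
    refine ⟨π, ⟨hπ, mem_P2 _ _⟩, ?_, fun hmono => ⟨2, fun k => (hπW k).trans ?_⟩⟩
    · refine tendsto_of_tendsto_of_tendsto_of_le_of_le tendsto_const_nhds ?_
        (fun _ => zero_le) hπW
      simpa using ENNReal.Tendsto.const_mul hW_lim (a := 2) (Or.inr (by simp))
    · rw [htW]
      push_cast
      gcongr
      exact ht_iter hmono k
  · intro hsum hmono
    -- Summability is assumed only for positive arguments; at t₀ = 0 the iterates vanish.
    have hs : Summable fun j => θ^[j] t₀ := by
      rcases eq_or_ne t₀ 0 with rfl | h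
      · simp_rw [Function.iterate_fixed hθ0]
        exact summable_zero
      · exact hsum t₀ ⟨pos_iff_ne_zero.2 h, htbar⟩
    -- The step length is at most t_k + θ(t_k) ≤ 2t_k, whence the constant 2.
    have hstep_len : ∀ k, W2 (blockProb η) (μ k) (μ (k + 1)) ≤ 2 * (θ^[k] t₀ : ℝ≥0) := fun k => by
      have hk := ht_iter hmono k
      have hkb := hk.trans (iterate_le htbar.le hle k)
      refine (hone k).2.trans ?_
      rw [two_mul]
      exact_mod_cast add_le_add hk ((hle _ hkb).trans hk)
    obtain ⟨π, hπ, hπW⟩ := exists_forall_W2_le hη hinv' (isClosed_inv hTc)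
      (W2_le_tsum hη hs hstep_len) hW_lim
    refine ⟨π, ⟨hπ, mem_P2 _ _⟩, ?_, 2, hπW⟩
    refine tendsto_of_tendsto_of_tendsto_of_le_of_le tendsto_const_nhds ?_
      (fun _ => zero_le) hπW
    have h1 : Tendsto (fun k => ((∑' j, θ^[k + j] t₀ : ℝ≥0) : ℝ≥0∞)) atTop (𝓝 0) := by
      refine (ENNReal.tendsto_coe.2 (NNReal.tendsto_sum_nat_add fun j => θ^[j] t₀)).congr
        fun k => ?_
      simp_rw [add_comm k]
    simpa using ENNReal.Tendsto.const_mul h1 (a := 2) (Or.inr (by simp))
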